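/- **Setting.** Consider a stochastic game with a principal (player $0$) and agents $1,\dots,n$, a finite state space $S$, an initial state $s_{\mathrm{init}}\in S$, a finite action set $A$ for every player, $\mathbf A=A^{n+1}$, transition probabilities $p(\cdot\mid s,\mathbf a)\in\Delta(S)$, rewards $\mathbf r(s,\mathbf a)\in\mathbb R^{n+1}$ and a discount factor $\gamma\in[0,1)$. Let $\Sigma$ be the set of finite histories $\sigma=(s^1,\mathbf a^1,\mathbf b^1;\dots;s^\ell,\mathbf a^\ell,\mathbf b^\ell)$, $\ell\ge 0$, of states, recommended joint actions $\mathbf a^t$ and performed joint actions $\mathbf b^t$; the sequence $(\sigma;s)$ *starts at* $s^1$ (at $s$ if $\sigma=\varnothing$). A policy is a map $\pi:\Sigma\times S\to\Delta(\mathbf A)$, and a deviation plan of agent $i$ is a map $\rho:\Sigma\times S\times A\to A$. Write $\mathbf a\oplus_i b$ for $\mathbf a$ with the $i$-th entry replaced by $b$. $V^{\pi,\rho}(\sigma;s)\in\mathbb R^{n+1}$ is the vector of expected discounted sums of rewards from $(\sigma;s)$ onward, when recommendations are drawn from $\pi$, agent $i$ follows $\rho$ and all others obey, and $$Q^{\pi,\rho}(\sigma;s,\mathbf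 a)=\mathbf r(s,\mathbf a')+\gamma\,\mathbb E_{s'\sim p(\cdot\mid s,\mathbf a')}V^{\pi,\rho}(\sigma;s,\mathbf a,\mathbf a';s'),\qquad \mathbf a'=\mathbf a\oplus_i\rho(\sigma;s,a_i).$$ $V^\pi,Q^\pi$ are the values without deviation, and $V^\pi(s)=V^\pi(\varnothing;s)$. The policy $\pi$ is *$\delta$-IC at $(\sigma;s)$* if for every agent $i\in\{1,\dots,n\}$, every $a\in A$ and every deviation plan $\rho$ of agent $i$, $$\sum_{\mathbf a:a_i=a}\pi(\mathbf a\mid\sigma;s)\,Q^\pi_i(\sigma;s,\mathbf a)\ \ge\ \sum_{\mathbf a:a_i=a}\pi(\mathbf a\mid\sigma;s)\,Q^{\pi,\rho}_i(\sigma;s,\mathbf a)-\delta .$$ It is a *$\delta$-CE* if it is $\delta$-IC at every $(\sigma;s)\in\Sigma\times S$, and a *$\delta$-CE of the game started at $s_0$* if it is $\delta$-IC at every $(\sigma;s)$ that starts at $s_0$. Let $\operatorname{neigh}_\eta(\mathbf x)=\{\mathbf x':\|\mathbf x'-\mathbf x\|_\infty\le\eta\}$ and $\operatorname{neigh}_\eta(X)=\bigcup_{\mathbf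 x\in X}\operatorname{neigh}_\eta(\mathbf x)$. A vector $\mathbf v$ is *$(\epsilon,\delta)$-inducible* at $s$ if $V^\pi(s)\in\operatorname{neigh}_\epsilon(\mathbf v)$ for some $\delta$-CE $\pi$. For $\mathcal V$ assigning to each $s\in S$ a set $\mathcal V(s)\subseteq\mathbb R^{n+1}$, let $\mathcal F_s(\mathcal V)$ be the set of pairs $(\bar\pi,\mathbf w)$ with $\bar\pi\in\Delta(\mathbf A)$ and $\mathbf w:\mathbf A^2\times S\to\mathbb R^{n+1}$ such that $\mathbf w(\mathbf a,\mathbf b;s')\in\mathcal V(s')$ for all $\mathbf a,\mathbf b,s'$, and for all agents $i\in\{1,\dots,n\}$ and all $a,b\in A$ $$\sum_{\mathbf a:a_i=a}\bar\pi(\mathbf a)\Big(r_i(s,\mathbf a)+\gamma\,\mathbb E_{s'\sim p(\cdot\mid s,\mathbf a)}w_i(\mathbf a,\mathbf a;s')\Big)\ge\sum_{\mathbf a:a_i=a}\bar\pi(\mathbf a)\Big(r_i(s,\mathbf a\oplus_i b)+\gamma\,\mathbb E_{s'\sim p(\cdot\mid s,\mathbf a\oplus_i b)}w_i(\mathbf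 a,\mathbf a\oplus_i b;s')\Big).$$ Put $\operatorname{Bellman}(s,\bar\pi,\mathbf w)=\mathbb E_{\mathbf a\sim\bar\pi}\big(\mathbf r(s,\mathbf a)+\gamma\,\mathbb E_{s'\sim p(\cdot\mid s,\mathbf a)}\mathbf w(\mathbf a,\mathbf a;s')\big)$ and $\Phi(\mathcal V)(s)=\{\operatorname{Bellman}(s,\bar\pi,\mathbf w):(\bar\pi,\mathbf w)\in\mathcal F_s(\mathcal V)\}$. For $\epsilon,\delta\ge 0$ let $\xi=(1-\gamma)\min\{\epsilon,\delta/2\}$, $G_\xi=\{\xi\mathbf x:\mathbf x\in\mathbb Z^{n+1}\}$ and $\widehat\Phi(\mathcal V)(s)=\operatorname{conv}\big(\operatorname{neigh}_\xi(\Phi(\mathcal V)(s))\cap G_\xi\big)$. **Algorithm 2.** On input $(\sigma;s)$ with $|\sigma|=\ell$, and a target vector $\mathbf v$, put $\mathbf v^1=\mathbf v$ and $s^{\ell+1}=s$. For $t=1,\dots,\ell+1$, find $\tilde{\mathbf v}^t\in\operatorname{neigh}_\xi(\mathbf v^t)$ and $(\bar\pi^t,\mathbf w^t)\in\mathcal F_{s^t}(\mathcal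 V)$ with $\tilde{\mathbf v}^t=\operatorname{Bellman}(s^t,\bar\pi^t,\mathbf w^t)$, and if $t\le\ell$ put $\mathbf v^{t+1}=\mathbf w^t(\mathbf a^t,\mathbf b^t;s^{t+1})$. Return $\bar\pi^{\ell+1}$. The search step is any fixed rule that returns a suitable triple whenever there is one; its choice is determined by $\mathbf v^t$, $s^t$ and the history before step $t$, so that it is the same for all inputs that agree up to that point. **Statement.** Let $\epsilon,\delta\ge 0$, and let $\mathcal V=\widehat\Phi(\mathcal V)$, where every $\mathcal V(s)$ is bounded. 1. Let $\mathbf v\in\mathcal V(s_{\mathrm{init}})$. On every input $(\sigma;s)$ starting at $s_{\mathrm{init}}$, with target $\mathbf v$, the search step of Algorithm 2 succeeds in every iteration. If $\pi$ is a policy such that $\pi(\sigma;s)$ is the output of Algorithm 2 for every $(\sigma;s)$ starting at $s_{\mathrm{init}}$, then $\pi$ is a $\delta$-CE of the game started at $s_{\mathrm{init}}$, and $V^\pi(s_{\mathrm{init}})\in\operatorname{neigh}_\epsilon(\mathbf v)$. 2. Let $\mathbf v_s\in\mathcal V(s)$ for every $s\in S$. If, for every $(\sigma;s)\in\Sigma\times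 S$, $\pi(\sigma;s)$ is the output of Algorithm 2 with target $\mathbf v_{s_0}$, where $s_0$ is the state at which $(\sigma;s)$ starts, then $\pi$ is a $\delta$-CE, and $V^\pi(s)\in\operatorname{neigh}_\epsilon(\mathbf v_s)$ for every $s\in S$. 3. For every $s\in S$, every $\mathbf v\in\mathcal V(s)$ is $(\epsilon,\delta)$-inducible at $s$. -/

import Mathlib

/-- Value vectors: one real coordinate per player, with the sup norm. Player `0` is the principal,
players `i ≠ 0` are the `n` agents. -/
abbrev ValueVec (n : ℕ) : Type := Fin (n + 1) → ℝ

/-- Joint actions of the `n + 1` players. -/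
abbrev JointAction (n : ℕ) (A : Type*) : Type _ := Fin (n + 1) → A

/-- Interaction histories: for each past time step the state, the recommended joint action and the
joint action performed. The list is stored with the MOST RECENT time step first, so that
`(s, a, b) :: σ` is the history `σ` followed by the step `(s, a, b)`. -/
abbrev History (n : ℕ) (S A : Type*) : Type _ := List (S × JointAction n A × JointAction n A)

/-- The state in which the sequence `(σ; s)` starts. -/
def History.start {n : ℕ} {S A : Type*} : History n S A → S → S
  | [], s => s
  | (s₁, _, _) :: σ, _ => History.start σ s₁

/-- A discounted stochastic game with a principal and `n` agents. -/
structure StochGame (n : ℕ) (S A : Type*) [Fintype S] where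
  /-- initial state -/
  sInit : S
  /-- transition probabilities `p(· | s, a)` -/
  p : S → JointAction n A → stdSimplex ℝ S
  /-- rewards of all players -/
  r : S → JointAction n A → ValueVec n
  /-- discount factor -/
  γ : ℝ
  γ_nonneg : 0 ≤ γ
  γ_lt_one : γ < 1

/-- History-dependent correlation policies. -/
abbrev CorrPolicy (n : ℕ) (S A : Type*) [Fintype A] : Type _ :=
  History n S A → S → stdSimplex ℝ (JointAction n A)

/-- Deviation plans of a single agent. -/
abbrev DeviationPlan (n : ℕ) (S A : Type*) : Type _ := History n S A → S → A → A

/-- A response rule: the joint action performed when the joint action in the last argument has been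
recommended. -/
abbrev Response (n : ℕ) (S A : Type*) : Type _ :=
  History n S A → S → JointAction n A → JointAction n A

/-- Nobody deviates. -/
def obey {n : ℕ} {S A : Type*} : Response n S A := fun _ _ a => a

/-- Agent `i` follows the deviation plan `ρ`, all other players obey. -/
def deviate {n : ℕ} {S A : Type*} (i : Fin (n + 1)) (ρ : DeviationPlan n S A) : Response n S A :=
  fun σ s a => Function.update a i (ρ σ s (a i))

/-- The closed sup-norm neighborhood of a point. -/
def neighPt {n : ℕ} (η : ℝ) (x : ValueVec n) : Set (ValueVec n) := {x' | ‖x' - x‖ ≤ η}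

/-- The neighborhood of a set. -/
def neighSet {n : ℕ} (η : ℝ) (X : Set (ValueVec n)) : Set (ValueVec n) := ⋃ x ∈ X, neighPt η x

/-- The grid of all points whose coordinates are integer multiples of `η`. -/
def gridPts (n : ℕ) (η : ℝ) : Set (ValueVec n) :=
  {g | ∃ x : Fin (n + 1) → ℤ, g = fun i => η * (x i : ℝ)}

/-- Onward values `w(a, b; s')`. -/
abbrev Onward (n : ℕ) (S A : Type*) : Type _ := JointAction n A → JointAction n A → S → ValueVec n

/-- The data found in one iteration of the expansion procedure: a value, a distribution of joint
actions, and onward values. -/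
structure Expansion (n : ℕ) (S A : Type*) [Fintype A] where
  value : ValueVec n
  dist : stdSimplex ℝ (JointAction n A)
  onward : Onward n S A

namespace StochGame

variable {n : ℕ} {S A : Type*} [Fintype S] [Fintype A] (G : StochGame n S A)

/-- `r(s, b) + γ 𝔼_{s' ∼ p(· | s, b)} f(s')`. -/
noncomputable def lookahead (s : S) (b : JointAction n A) (f : S → ValueVec n) : ValueVec n :=
  G.r s b + G.γ • ∑ s', G.p s b s' • f s'

/-! ### Values of policies -/

/-- The expected reward vector `k` time steps after the sequence `(σ; s)`, when recommendations are
drawn from `π` and the players respond according to `d`. -/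
noncomputable def expReward (π : CorrPolicy n S A) (d : Response n S A) :
    ℕ → History n S A → S → ValueVec n
  | 0, σ, s => ∑ a, π σ s a • G.r s (d σ s a)
  | k + 1, σ, s => ∑ a, π σ s a •
      ∑ s', G.p s (d σ s a) s' • expReward π d k ((s, a, d σ s a) :: σ) s'

/-- The V-value: the expected discounted sum of rewards from `(σ; s)` onward. -/
noncomputable def valueV (π : CorrPolicy n S A) (d : Response n S A) (σ : History n S A) (s : S) :
    ValueVec n :=
  ∑' k : ℕ, G.γ ^ k • G.expReward π d k σ s

/-- The Q-value. -/
noncomputable def valueQ (π : CorrPolicy n S A) (d : Response n S A) (σ : History n S A) (s : S)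
    (a : JointAction n A) : ValueVec n :=
  G.lookahead s (d σ s a) (fun s' => G.valueV π d ((s, a, d σ s a) :: σ) s')

/-- The incentive constraints of a `δ`-CE at the sequence `(σ; s)`: for every agent, every
recommendation to it, and every deviation plan. -/
def ICAt [DecidableEq A] (δ : ℝ) (π : CorrPolicy n S A) (σ : History n S A) (s : S) : Prop :=
  ∀ i : Fin (n + 1), i ≠ 0 → ∀ (x : A) (ρ : DeviationPlan n S A),
    (∑ a with a i = x, π σ s a * G.valueQ π obey σ s a i) ≥
      (∑ a with a i = x, π σ s a * G.valueQ π (deviate i ρ) σ s a i) - δ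

/-- `π` is a `δ`-CE. -/
def IsDeltaCE [DecidableEq A] (δ : ℝ) (π : CorrPolicy n S A) : Prop :=
  ∀ (σ : History n S A) (s : S), G.ICAt δ π σ s

/-- `π` is a `δ`-CE of the game started at `s₀`: the incentive constraints hold at every sequence
that starts at `s₀`. (The distributions `π` assigns to other sequences are irrelevant.) -/
def IsDeltaCEFrom [DecidableEq A] (δ : ℝ) (s₀ : S) (π : CorrPolicy n S A) : Prop :=
  ∀ (σ : History n S A) (s : S), History.start σ s = s₀ → G.ICAt δ π σ s

/-- `v` is `δ`-inducible at `s`. -/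
def IsInducible [DecidableEq A] (δ : ℝ) (s : S) (v : ValueVec n) : Prop :=
  ∃ π : CorrPolicy n S A, G.IsDeltaCE δ π ∧ v = G.valueV π obey [] s

/-- `v` is `(ε, δ)`-inducible at `s`. -/
def IsApproxInducible [DecidableEq A] (ε δ : ℝ) (s : S) (v : ValueVec n) : Prop :=
  ∃ v' ∈ neighPt ε v, G.IsInducible δ s v'

/-! ### The maps on value-set functions -/

/-- `𝔼_{a ∼ μ} (r(s, a) + γ 𝔼_{s'} w(a, a; s'))`. -/
noncomputable def bellman (s : S) (μ : stdSimplex ℝ (JointAction n A)) (w : Onward n S A) :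
    ValueVec n :=
  ∑ a, μ a • G.lookahead s a (w a a)

/-- The set of feasible pairs: one-step incentive constraints, and onward values in `𝒱`. -/
def feasible [DecidableEq A] (𝒱 : S → Set (ValueVec n)) (s : S) :
    Set (stdSimplex ℝ (JointAction n A) × Onward n S A) :=
  {q | (∀ i : Fin (n + 1), i ≠ 0 → ∀ x b : A,
          ∑ a with a i = x, q.1 a * G.lookahead s a (q.2 a a) i ≥
            ∑ a with a i = x, q.1 a *
              G.lookahead s (Function.update a i b) (q.2 a (Function.update a i b)) i) ∧
        ∀ a b s', q.2 a b s' ∈ 𝒱 s'}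

/-- The exact map `Φ`. -/
def Phi [DecidableEq A] (𝒱 : S → Set (ValueVec n)) (s : S) : Set (ValueVec n) :=
  {v | ∃ q ∈ G.feasible 𝒱 s, v = G.bellman s q.1 q.2}

/-- The approximate map `Φ̂` with precision `ξ`. -/
def PhiHat [DecidableEq A] (ξ : ℝ) (𝒱 : S → Set (ValueVec n)) (s : S) : Set (ValueVec n) :=
  convexHull ℝ (neighSet ξ (G.Phi 𝒱 s) ∩ gridPts n ξ)

/-- The precision `ξ = (1 - γ) min {ε, δ / 2}`. -/
noncomputable def precision (ε δ : ℝ) : ℝ := (1 - G.γ) * min ε (δ / 2)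

/-! ### The expansion procedure -/

/-- What has to be found in an iteration with current state `s` and current target `u`: a value
within `ξ` of `u` that is the Bellman value of a feasible pair. -/
def IsExpansion [DecidableEq A] (ξ : ℝ) (𝒱 : S → Set (ValueVec n)) (s : S) (u : ValueVec n)
    (c : Expansion n S A) : Prop :=
  c.value ∈ neighPt ξ u ∧ (c.dist, c.onward) ∈ G.feasible 𝒱 s ∧
    c.value = G.bellman s c.dist c.onward

/-- `find` implements the search step: given the history before the current step, the current state
and the current target, it returns a suitable expansion whenever there is one. -/
def IsFindRule [DecidableEq A] (ξ : ℝ) (𝒱 : S → Set (ValueVec n))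
    (find : History n S A → S → ValueVec n → Expansion n S A) : Prop :=
  ∀ (σ : History n S A) (s : S) (u : ValueVec n),
    (∃ c, G.IsExpansion ξ 𝒱 s u c) → G.IsExpansion ξ 𝒱 s u (find σ s u)

end StochGame

/-- The target of the last iteration of the procedure on input `(σ; s)` and `v`: the first target is
`v`, and each further target is the onward value, found in the previous iteration, of the actions
recommended and performed there and of the state that followed. -/
def algTarget {n : ℕ} {S A : Type*} [Fintype A]
    (find : History n S A → S → ValueVec n → Expansion n S A) (v : ValueVec n) :
    History n S A → S → ValueVec n
  | [], _ => v
  | (s, a, b) :: σ, s' => (find σ s (algTarget find v σ s)).onward a b s'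

/-- The expansion found in the last iteration of the procedure on input `(σ; s)` and `v`. -/
def algLast {n : ℕ} {S A : Type*} [Fintype A]
    (find : History n S A → S → ValueVec n → Expansion n S A) (v : ValueVec n)
    (σ : History n S A) (s : S) : Expansion n S A :=
  find σ s (algTarget find v σ s)

/-- The output of the procedure on input `(σ; s)` and `v`. -/
def algOutput {n : ℕ} {S A : Type*} [Fintype A]
    (find : History n S A → S → ValueVec n → Expansion n S A) (v : ValueVec n)
    (σ : History n S A) (s : S) : stdSimplex ℝ (JointAction n A) :=
  (algLast find v σ s).dist

namespace StochGame

variable {n : ℕ} {S A : Type*} [Fintype S] [Fintype A] (G : StochGame n S A)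

theorem norm_simplexAvg_le {X : Type*} [Fintype X] {C : ℝ} (μ : stdSimplex ℝ X)
    (f : X → ValueVec n) (hf : ∀ x, ‖f x‖ ≤ C) : ‖∑ x, μ x • f x‖ ≤ C := by
  have h0 : ∀ x, 0 ≤ μ x := μ.2.1
  have h1 : ∑ x, μ x = 1 := μ.2.2
  calc ‖∑ x, μ x • f x‖ ≤ ∑ x, μ x * C := by
        refine norm_sum_le_of_le _ fun x _ => ?_
        rw [norm_smul, Real.norm_of_nonneg (h0 x)]
        exact mul_le_mul_of_nonneg_left (hf x) (h0 x)
    _ = C := by rw [← Finset.sum_mul, h1, one_mul]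

theorem norm_expReward_le (π : CorrPolicy n S A) (d : Response n S A) :
    ∃ C : ℝ, ∀ k σ s, ‖G.expReward π d k σ s‖ ≤ C := by
  obtain ⟨C, hC⟩ : ∃ C : ℝ, ∀ s a, ‖G.r s a‖ ≤ C := by
    refine ⟨∑ s, ∑ a, ‖G.r s a‖, fun s a => ?_⟩
    refine le_trans ?_ (Finset.single_le_sum
      (f := fun s => ∑ a, ‖G.r s a‖) (fun s _ => by positivity) (Finset.mem_univ s))
    exact Finset.single_le_sum (f := fun a => ‖G.r s a‖) (fun a _ => by positivity)
      (Finset.mem_univ a)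
  refine ⟨C, fun k => ?_⟩
  induction k with
  | zero => exact fun σ s => norm_simplexAvg_le _ _ fun a => hC _ _
  | succ k ih => exact fun σ s => norm_simplexAvg_le _ _ fun a => norm_simplexAvg_le _ _ fun s' => ih _ _

theorem summable_expReward (π : CorrPolicy n S A) (d : Response n S A) (σ : History n S A)
    (s : S) : Summable fun k : ℕ => G.γ ^ k • G.expReward π d k σ s := by
  obtain ⟨C, hC⟩ := G.norm_expReward_le π d
  refine Summable.of_norm_bounded
    ((summable_geometric_of_lt_one G.γ_nonneg G.γ_lt_one).mul_right C) fun k => ?_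
  rw [norm_smul, Real.norm_of_nonneg (pow_nonneg G.γ_nonneg k)]
  exact mul_le_mul_of_nonneg_left (hC k σ s) (pow_nonneg G.γ_nonneg k)

/-- The recursion between V- and Q-values. -/
theorem valueV_eq (π : CorrPolicy n S A) (d : Response n S A) (σ : History n S A) (s : S) :
    G.valueV π d σ s = ∑ a, π σ s a • G.valueQ π d σ s a := by
  have key : ∀ a, HasSum (fun k : ℕ => G.γ ^ (k + 1) • π σ s a •
      ∑ s', G.p s (d σ s a) s' • G.expReward π d k ((s, a, d σ s a) :: σ) s')
      (π σ s a • G.γ • ∑ s', G.p s (d σ s a) s' • G.valueV π d ((s, a, d σ s a) :: σ) s') := by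
    intro a
    have h := (hasSum_sum (s := Finset.univ) fun s' _ =>
      ((G.summable_expReward π d ((s, a, d σ s a) :: σ) s').hasSum.const_smul
        (G.p s (d σ s a) s'))).const_smul G.γ |>.const_smul (π σ s a)
    refine (congrArg (fun f => HasSum f _) (funext fun k => ?_)).mp h
    simp only [Finset.smul_sum, smul_smul]
    refine Finset.sum_congr rfl fun s' _ => ?_
    congr 1
    ring
  have h2 := hasSum_sum (s := Finset.univ) fun a _ => key a
  rw [valueV, (G.summable_expReward π d σ s).tsum_eq_zero_add]
  have h3 : ∀ k, G.γ ^ (k + 1) • G.expReward π d (k + 1) σ s = ∑ a, G.γ ^ (k + 1) • π σ s a •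
      ∑ s', G.p s (d σ s a) s' • G.expReward π d k ((s, a, d σ s a) :: σ) s' := by
    intro k
    rw [expReward, Finset.smul_sum]
  rw [tsum_congr h3, h2.tsum_eq]
  simp [expReward, valueQ, lookahead, smul_add, Finset.sum_add_distrib]

end StochGame

/-!
Every target met by the expansion procedure stays in `𝒱`, because the onward values of a feasible
pair do. So the search succeeds in every iteration once each `u ∈ 𝒱 s` is within `ξ` of `Φ(𝒱)(s)`.
By the fixed-point equation `u` is a convex combination of points within `ξ` of `Φ(𝒱)(s)`, and
`Φ(𝒱)(s)` is convex (`convex_Phi`): two feasible pairs are mixed by averaging the distributions and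
the recommendation-weighted onward values, which enter all constraints linearly. Here the sets
`𝒱 s` are convex, being convex hulls.

Each iteration moves the target by at most `ξ`, and later errors are discounted by `γ`. The distance
between the value of the computed policy and the current target is a bounded function of the
history, so the supremum `M` of this distance satisfies `M ≤ ξ + γ M`, that is
`M ≤ ξ / (1 - γ) = min {ε, δ / 2}` (`norm_valueV_sub_target_le`). In the same way, the one-step
incentive constraints bound by `min {ε, δ / 2}` the excess of a deviating agent's value over its
coordinate of the target (`valueV_deviate_le`). A deviation therefore gains at most
`2 γ min {ε, δ / 2} ≤ δ`.
-/

/-! ### Bounds for contractions, averages and neighborhoods -/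

/-- A bounded function whose upper bounds `M` can always be improved to `(1 - γ) η + γ M` is at
most `η`, the fixed point of this improvement. -/
theorem le_of_forall_le_add_mul {X : Type*} {f : X → ℝ} {γ η : ℝ} (hγ : γ < 1)
    (hf : BddAbove (Set.range f))
    (h : ∀ M, (∀ x, f x ≤ M) → ∀ x, f x ≤ (1 - γ) * η + γ * M) (x : X) : f x ≤ η := by
  have : Nonempty X := ⟨x⟩
  have hM : ⨆ x, f x ≤ (1 - γ) * η + γ * ⨆ x, f x :=
    ciSup_le (h _ fun y => le_ciSup hf y)
  have hx : f x ≤ ⨆ x, f x := le_ciSup hf x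
  nlinarith

theorem simplexAvg_le {X : Type*} [Fintype X] {C : ℝ} (μ : stdSimplex ℝ X)
    (f : X → ℝ) (hf : ∀ x, f x ≤ C) : ∑ x, μ x * f x ≤ C := by
  calc ∑ x, μ x * f x ≤ ∑ x, μ x * C :=
        Finset.sum_le_sum fun x _ => mul_le_mul_of_nonneg_left (hf x) (μ.2.1 x)
    _ = C := by rw [← Finset.sum_mul, show ∑ x, μ x = 1 from μ.2.2, one_mul]

/-- A point of a convex set that represents the mixture of two of its points with unnormalized
nonnegative weights. If both weights vanish, any point does. -/
theorem Convex.exists_add_smul_eq {E : Type*} [AddCommGroup E] [Module ℝ E] {K : Set E}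
    (hK : Convex ℝ K) {x y : E} (hx : x ∈ K) (hy : y ∈ K) {c₁ c₂ : ℝ} (h₁ : 0 ≤ c₁)
    (h₂ : 0 ≤ c₂) : ∃ z ∈ K, (c₁ + c₂) • z = c₁ • x + c₂ • y := by
  rcases eq_or_lt_of_le (add_nonneg h₁ h₂) with h | h
  · obtain rfl : c₁ = 0 := by linarith
    obtain rfl : c₂ = 0 := by linarith
    exact ⟨x, hx, by simp⟩
  -- Otherwise the point is the convex combination with the normalized weights.
  · refine ⟨_, hK hx hy (div_nonneg h₁ h.le) (div_nonneg h₂ h.le) (by field_simp), ?_⟩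
    rw [smul_add, smul_smul, smul_smul, mul_div_cancel₀ _ h.ne', mul_div_cancel₀ _ h.ne']

theorem convexHull_neighSet_subset {n : ℕ} {η : ℝ} {X : Set (ValueVec n)} (hX : Convex ℝ X) :
    convexHull ℝ (neighSet η X) ⊆ neighSet η X := by
  refine (Convex.convexHull_eq ?_).subset
  intro x hx y hy t₁ t₂ ht₁ ht₂ ht
  simp only [neighSet, neighPt, Set.mem_iUnion₂, Set.mem_ofPred_eq] at hx hy ⊢
  obtain ⟨x', hx', hxx⟩ := hx
  obtain ⟨y', hy', hyy⟩ := hy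
  refine ⟨_, hX hx' hy' ht₁ ht₂ ht, ?_⟩
  calc ‖t₁ • x + t₂ • y - (t₁ • x' + t₂ • y')‖ = ‖t₁ • (x - x') + t₂ • (y - y')‖ := by
        congr 1; module
    _ ≤ t₁ * η + t₂ * η := by
        refine norm_add_le_of_le ?_ ?_
        · rw [norm_smul, Real.norm_of_nonneg ht₁]
          exact mul_le_mul_of_nonneg_left hxx ht₁
        · rw [norm_smul, Real.norm_of_nonneg ht₂]
          exact mul_le_mul_of_nonneg_left hyy ht₂
    _ = η := by rw [← add_mul, ht, one_mul]

namespace StochGame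

/-! ### Lookaheads and values in coordinates -/

variable {n : ℕ} {S A : Type*} [Fintype S] (G : StochGame n S A)

theorem lookahead_apply (s : S) (b : JointAction n A) (f : S → ValueVec n) (i : Fin (n + 1)) :
    G.lookahead s b f i = G.r s b i + G.γ * ∑ s', G.p s b s' * f s' i := by
  simp [lookahead, Finset.sum_apply]

theorem lookahead_apply_le {f g : S → ValueVec n} {i : Fin (n + 1)} {M : ℝ} (s : S)
    (b : JointAction n A) (h : ∀ s', f s' i - g s' i ≤ M) :
    G.lookahead s b f i ≤ G.lookahead s b g i + G.γ * M := by
  have h1 := simplexAvg_le (G.p s b) (fun s' => f s' i - g s' i) h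
  simp only [mul_sub, Finset.sum_sub_distrib] at h1
  have h2 := mul_le_mul_of_nonneg_left h1 G.γ_nonneg
  rw [lookahead_apply, lookahead_apply]
  linarith

theorem norm_lookahead_sub_le {f g : S → ValueVec n} {M : ℝ} (s : S)
    (b : JointAction n A) (h : ∀ s', ‖f s' - g s'‖ ≤ M) :
    ‖G.lookahead s b f - G.lookahead s b g‖ ≤ G.γ * M := by
  have h1 := norm_simplexAvg_le (G.p s b) (fun s' => f s' - g s') h
  simp only [smul_sub, Finset.sum_sub_distrib] at h1
  rw [lookahead, lookahead, add_sub_add_left_eq_sub, ← smul_sub, norm_smul,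
    Real.norm_of_nonneg G.γ_nonneg]
  exact mul_le_mul_of_nonneg_left h1 G.γ_nonneg

/-- A lookahead weighted by the probability of a recommendation is additive in that probability and
in the correspondingly weighted onward values. -/
theorem mul_lookahead_mix (s : S) (b : JointAction n A) {c c₁ c₂ : ℝ} {f f₁ f₂ : S → ValueVec n}
    (hc : c = c₁ + c₂) (hf : ∀ s', c • f s' = c₁ • f₁ s' + c₂ • f₂ s') (i : Fin (n + 1)) :
    c * G.lookahead s b f i = c₁ * G.lookahead s b f₁ i + c₂ * G.lookahead s b f₂ i := by
  have h : c * ∑ s', G.p s b s' * f s' i =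
      c₁ * (∑ s', G.p s b s' * f₁ s' i) + c₂ * ∑ s', G.p s b s' * f₂ s' i := by
    simp only [Finset.mul_sum, ← Finset.sum_add_distrib]
    refine Finset.sum_congr rfl fun s' _ => ?_
    have := congrFun (hf s') i
    simp only [Pi.smul_apply, Pi.add_apply, smul_eq_mul] at this
    linear_combination G.p s b s' * this
  simp only [lookahead_apply]
  linear_combination G.r s b i * hc + G.γ * h

variable [Fintype A]

theorem bellman_apply (s : S) (μ : stdSimplex ℝ (JointAction n A)) (w : Onward n S A)
    (i : Fin (n + 1)) : G.bellman s μ w i = ∑ a, μ a * G.lookahead s a (w a a) i := by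
  simp [bellman, Finset.sum_apply]

theorem valueV_apply (π : CorrPolicy n S A) (d : Response n S A) (σ : History n S A) (s : S)
    (i : Fin (n + 1)) : G.valueV π d σ s i = ∑ a, π σ s a * G.valueQ π d σ s a i := by
  rw [valueV_eq]
  simp [Finset.sum_apply]

theorem norm_valueV_le (π : CorrPolicy n S A) (d : Response n S A) :
    ∃ C : ℝ, ∀ σ s, ‖G.valueV π d σ s‖ ≤ C := by
  obtain ⟨C, hC⟩ := G.norm_expReward_le π d
  refine ⟨∑' k : ℕ, G.γ ^ k * C, fun σ s => ?_⟩
  refine tsum_of_norm_bounded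
    ((summable_geometric_of_lt_one G.γ_nonneg G.γ_lt_one).mul_right C).hasSum fun k => ?_
  rw [norm_smul, Real.norm_of_nonneg (pow_nonneg G.γ_nonneg k)]
  exact mul_le_mul_of_nonneg_left (hC k σ s) (pow_nonneg G.γ_nonneg k)

/-! ### Convexity of the exact map -/

theorem convex_Phi [DecidableEq A] {𝒱 : S → Set (ValueVec n)} (h𝒱 : ∀ s, Convex ℝ (𝒱 s)) (s : S) :
    Convex ℝ (G.Phi 𝒱 s) := by
  rintro _ ⟨⟨μ₁, w₁⟩, ⟨hic₁, hw₁⟩, rfl⟩ _ ⟨⟨μ₂, w₂⟩, ⟨hic₂, hw₂⟩, rfl⟩ t₁ t₂ ht₁ ht₂ ht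
  choose w hw hmix using fun a b s' => (h𝒱 s').exists_add_smul_eq (hw₁ a b s') (hw₂ a b s')
    (mul_nonneg ht₁ (μ₁.2.1 a)) (mul_nonneg ht₂ (μ₂.2.1 a))
  let μ : stdSimplex ℝ (JointAction n A) :=
    ⟨t₁ • ⇑μ₁ + t₂ • ⇑μ₂, convex_stdSimplex ℝ _ μ₁.2 μ₂.2 ht₁ ht₂ ht⟩
  have key : ∀ a b i, μ a * G.lookahead s b (w a b) i =
      t₁ * (μ₁ a * G.lookahead s b (w₁ a b) i) + t₂ * (μ₂ a * G.lookahead s b (w₂ a b) i) := by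
    intro a b i
    rw [← mul_assoc, ← mul_assoc]
    exact G.mul_lookahead_mix s b rfl (hmix a b) i
  refine ⟨(μ, w), ⟨fun i hi x b => ?_, hw⟩, ?_⟩
  · simp only [key, Finset.sum_add_distrib, ← Finset.mul_sum]
    exact add_le_add (mul_le_mul_of_nonneg_left (hic₁ i hi x b) ht₁)
      (mul_le_mul_of_nonneg_left (hic₂ i hi x b) ht₂)
  · ext i
    simp only [Pi.add_apply, Pi.smul_apply, smul_eq_mul, bellman_apply, key,
      Finset.sum_add_distrib, Finset.mul_sum]

/-! ### Success of the search step -/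

theorem exists_isExpansion [DecidableEq A] {ξ : ℝ} {𝒱 : S → Set (ValueVec n)}
    (hfix : 𝒱 = G.PhiHat ξ 𝒱) {s : S} {u : ValueVec n} (hu : u ∈ 𝒱 s) :
    ∃ c, G.IsExpansion ξ 𝒱 s u c := by
  have hconv : ∀ s, Convex ℝ (𝒱 s) := fun s => by
    rw [hfix]
    exact convex_convexHull ℝ _
  have hu' : u ∈ neighSet ξ (G.Phi 𝒱 s) := by
    rw [hfix] at hu
    exact convexHull_neighSet_subset (G.convex_Phi hconv s)
      (convexHull_mono Set.inter_subset_left hu)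
  simp only [neighSet, neighPt, Set.mem_iUnion₂, Set.mem_ofPred_eq] at hu'
  obtain ⟨x, ⟨q, hq, hx⟩, hux⟩ := hu'
  exact ⟨⟨x, q.1, q.2⟩, by rwa [neighPt, Set.mem_ofPred_eq, norm_sub_rev], hq, hx⟩

theorem algTarget_mem [DecidableEq A] {ξ : ℝ} {𝒱 : S → Set (ValueVec n)}
    (hfix : 𝒱 = G.PhiHat ξ 𝒱) {find : History n S A → S → ValueVec n → Expansion n S A}
    (hfind : G.IsFindRule ξ 𝒱 find) {s₀ : S} {v : ValueVec n} (hv : v ∈ 𝒱 s₀) :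
    ∀ (σ : History n S A) (s : S), History.start σ s = s₀ → algTarget find v σ s ∈ 𝒱 s
  | [], _, h => by
    subst h
    exact hv
  | (s, a, b) :: σ, s', h =>
    (hfind σ s _ (G.exists_isExpansion hfix (algTarget_mem hfix hfind hv σ s h))).2.1.2 a b s'

theorem isExpansion_algLast [DecidableEq A] {ξ : ℝ} {𝒱 : S → Set (ValueVec n)}
    (hfix : 𝒱 = G.PhiHat ξ 𝒱) {find : History n S A → S → ValueVec n → Expansion n S A}
    (hfind : G.IsFindRule ξ 𝒱 find) {s₀ : S} {v : ValueVec n} (hv : v ∈ 𝒱 s₀)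
    (σ : History n S A) (s : S) (h : History.start σ s = s₀) :
    G.IsExpansion ξ 𝒱 s (algTarget find v σ s) (algLast find v σ s) :=
  hfind σ s _ (G.exists_isExpansion hfix (G.algTarget_mem hfix hfind hv σ s h))

/-! ### Values of the computed policy -/

section Computed

variable {η : ℝ} {𝒱 : S → Set (ValueVec n)}
  {find : History n S A → S → ValueVec n → Expansion n S A} {s₀ : S} {v : ValueVec n}
  {π : CorrPolicy n S A}

theorem exists_norm_valueV_sub_target_le (hbdd : ∀ s, Bornology.IsBounded (𝒱 s))
    (hmem : ∀ σ s, History.start σ s = s₀ → algTarget find v σ s ∈ 𝒱 s)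
    (π : CorrPolicy n S A) (d : Response n S A) :
    ∃ C : ℝ, ∀ σ s, History.start σ s = s₀ →
      ‖G.valueV π d σ s - algTarget find v σ s‖ ≤ C := by
  obtain ⟨C, hC⟩ := G.norm_valueV_le π d
  obtain ⟨D, hD⟩ := isBounded_iff_forall_norm_le.1 (Bornology.isBounded_iUnion.2 hbdd)
  exact ⟨C + D, fun σ s h =>
    norm_sub_le_of_le (hC σ s) (hD _ (Set.mem_iUnion.2 ⟨s, hmem σ s h⟩))⟩

variable [DecidableEq A]

/-- With search precision `(1 - γ) η`, the value of the computed policy stays within `η` of the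
current target: if all distances are at most `M`, then one Bellman step improves this bound to
`(1 - γ) η + γ M`. -/
theorem norm_valueV_sub_target_le (hbdd : ∀ s, Bornology.IsBounded (𝒱 s))
    (hmem : ∀ σ s, History.start σ s = s₀ → algTarget find v σ s ∈ 𝒱 s)
    (hexp : ∀ σ s, History.start σ s = s₀ →
      G.IsExpansion ((1 - G.γ) * η) 𝒱 s (algTarget find v σ s) (algLast find v σ s))
    (hπ : ∀ σ s, History.start σ s = s₀ → π σ s = algOutput find v σ s)
    (σ : History n S A) (s : S) (hs : History.start σ s = s₀) :
    ‖G.valueV π obey σ s - algTarget find v σ s‖ ≤ η := by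
  obtain ⟨C, hC⟩ := G.exists_norm_valueV_sub_target_le hbdd hmem π obey
  refine le_of_forall_le_add_mul (X := {q : History n S A × S // History.start q.1 q.2 = s₀})
    (f := fun q => ‖G.valueV π obey q.1.1 q.1.2 - algTarget find v q.1.1 q.1.2‖) G.γ_lt_one
    ⟨C, by rintro _ ⟨q, rfl⟩; exact hC _ _ q.2⟩ ?_ ⟨(σ, s), hs⟩
  rintro M hM ⟨⟨σ, s⟩, hs⟩
  obtain ⟨hval, -, hbell⟩ := hexp σ s hs
  refine (?_ : ‖G.valueV π obey σ s - algTarget find v σ s‖ ≤ _)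
  rw [add_comm ((1 - G.γ) * η)]
  refine (norm_sub_le_norm_sub_add_norm_sub _ (algLast find v σ s).value _).trans
    (add_le_add ?_ hval)
  rw [hbell, bellman, valueV_eq, hπ σ s hs, algOutput, ← Finset.sum_sub_distrib]
  simp only [← smul_sub]
  exact norm_simplexAvg_le _ _ fun a =>
    G.norm_lookahead_sub_le s a fun s' => hM ⟨((s, a, a) :: σ, s'), hs⟩

/-- If the onward value of a deviating agent exceeds its onward target by at most `M`, then on each
recommendation the deviation gains at most `γ M` over the value promised for obeying. -/
theorem sum_valueQ_deviate_le {M : ℝ} {i : Fin (n + 1)} (hi : i ≠ 0) {ξ : ℝ}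
    (hexp : ∀ σ s, History.start σ s = s₀ →
      G.IsExpansion ξ 𝒱 s (algTarget find v σ s) (algLast find v σ s))
    (hπ : ∀ σ s, History.start σ s = s₀ → π σ s = algOutput find v σ s)
    (ρ : DeviationPlan n S A)
    (hM : ∀ σ s, History.start σ s = s₀ →
      G.valueV π (deviate i ρ) σ s i - algTarget find v σ s i ≤ M)
    (σ : History n S A) (s : S) (hs : History.start σ s = s₀) (x : A) :
    ∑ a with a i = x, π σ s a * G.valueQ π (deviate i ρ) σ s a i ≤
      ∑ a with a i = x,
        π σ s a * (G.lookahead s a ((algLast find v σ s).onward a a) i + G.γ * M) := by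
  -- The deviation plan is free to vary with the history, but at `(σ; s)` and recommendation `x` it
  -- performs the single action `ρ σ s x`, to which the one-step constraint applies.
  have hic := (hexp σ s hs).2.1.1 i hi x (ρ σ s x)
  calc ∑ a with a i = x, π σ s a * G.valueQ π (deviate i ρ) σ s a i
      ≤ ∑ a with a i = x, π σ s a * (G.lookahead s (Function.update a i (ρ σ s x))
          ((algLast find v σ s).onward a (Function.update a i (ρ σ s x))) i + G.γ * M) := by
        refine Finset.sum_le_sum fun a ha => mul_le_mul_of_nonneg_left ?_ ((π σ s).2.1 a)
        obtain rfl := (Finset.mem_filter.1 ha).2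
        exact G.lookahead_apply_le s _ fun s' => hM _ _ hs
    _ ≤ _ := by
        rw [hπ σ s hs]
        simp only [mul_add, Finset.sum_add_distrib]
        exact add_le_add hic le_rfl

/-- With search precision `(1 - γ) η`, no deviation plan of agent `i` makes its value exceed its
coordinate of the current target by more than `η`. The bound is one-sided, as a deviation may be
arbitrarily bad for the agent. -/
theorem valueV_deviate_le (hbdd : ∀ s, Bornology.IsBounded (𝒱 s))
    (hmem : ∀ σ s, History.start σ s = s₀ → algTarget find v σ s ∈ 𝒱 s)
    (hexp : ∀ σ s, History.start σ s = s₀ →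
      G.IsExpansion ((1 - G.γ) * η) 𝒱 s (algTarget find v σ s) (algLast find v σ s))
    (hπ : ∀ σ s, History.start σ s = s₀ → π σ s = algOutput find v σ s)
    {i : Fin (n + 1)} (hi : i ≠ 0) (ρ : DeviationPlan n S A)
    (σ : History n S A) (s : S) (hs : History.start σ s = s₀) :
    G.valueV π (deviate i ρ) σ s i - algTarget find v σ s i ≤ η := by
  obtain ⟨C, hC⟩ := G.exists_norm_valueV_sub_target_le hbdd hmem π (deviate i ρ)
  refine le_of_forall_le_add_mul (X := {q : History n S A × S // History.start q.1 q.2 = s₀})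
    (f := fun q => G.valueV π (deviate i ρ) q.1.1 q.1.2 i - algTarget find v q.1.1 q.1.2 i)
    G.γ_lt_one ⟨C, by
      rintro _ ⟨q, rfl⟩
      exact (le_abs_self _).trans ((norm_le_pi_norm (_ - _ : ValueVec n) i).trans
        (hC _ _ q.2))⟩ ?_ ⟨(σ, s), hs⟩
  rintro M hM ⟨⟨σ, s⟩, hs⟩
  obtain ⟨hval, -, hbell⟩ := hexp σ s hs
  have hval_i : (algLast find v σ s).value i - algTarget find v σ s i ≤ (1 - G.γ) * η :=
    (le_abs_self _).trans ((norm_le_pi_norm (_ - _ : ValueVec n) i).trans hval)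
  have hdev : G.valueV π (deviate i ρ) σ s i ≤ (algLast find v σ s).value i + G.γ * M := by
    calc G.valueV π (deviate i ρ) σ s i
        = ∑ x, ∑ a with a i = x, π σ s a * G.valueQ π (deviate i ρ) σ s a i := by
          rw [valueV_apply, Finset.sum_fiberwise]
      _ ≤ ∑ x, ∑ a with a i = x,
            π σ s a * (G.lookahead s a ((algLast find v σ s).onward a a) i + G.γ * M) :=
          Finset.sum_le_sum fun x _ => G.sum_valueQ_deviate_le hi hexp hπ ρ
            (fun σ s h => hM ⟨(σ, s), h⟩) σ s hs x
      _ = (algLast find v σ s).value i + G.γ * M := by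
          rw [Finset.sum_fiberwise, hbell, bellman_apply, hπ σ s hs]
          simp only [mul_add, Finset.sum_add_distrib, ← Finset.sum_mul]
          rw [show ∑ a, algOutput find v σ s a = 1 from (algOutput find v σ s).2.2, one_mul]
          rfl
  show G.valueV π (deviate i ρ) σ s i - algTarget find v σ s i ≤ _
  linarith

/-- The continuation after obeying is worth at least the onward target minus `η`, and the one after
deviating at most the onward target plus `η`, so a deviation gains at most `2 γ η`. -/
theorem icAt_of_isExpansion (hbdd : ∀ s, Bornology.IsBounded (𝒱 s))
    (hmem : ∀ σ s, History.start σ s = s₀ → algTarget find v σ s ∈ 𝒱 s)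
    (hexp : ∀ σ s, History.start σ s = s₀ →
      G.IsExpansion ((1 - G.γ) * η) 𝒱 s (algTarget find v σ s) (algLast find v σ s))
    (hπ : ∀ σ s, History.start σ s = s₀ → π σ s = algOutput find v σ s)
    {δ : ℝ} (hη : 0 ≤ η) (hηδ : 2 * η ≤ δ)
    (σ : History n S A) (s : S) (hs : History.start σ s = s₀) : G.ICAt δ π σ s := by
  intro i hi x ρ
  have hdev := G.sum_valueQ_deviate_le hi hexp hπ ρ
    (G.valueV_deviate_le hbdd hmem hexp hπ hi ρ) σ s hs x
  have hobey : ∑ a with a i = x,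
      π σ s a * (G.lookahead s a ((algLast find v σ s).onward a a) i - G.γ * η) ≤
        ∑ a with a i = x, π σ s a * G.valueQ π obey σ s a i := by
    refine Finset.sum_le_sum fun a _ => mul_le_mul_of_nonneg_left ?_ ((π σ s).2.1 a)
    rw [sub_le_iff_le_add]
    refine G.lookahead_apply_le s a fun s' => ?_
    have h := G.norm_valueV_sub_target_le hbdd hmem hexp hπ ((s, a, a) :: σ) s' hs
    rw [norm_sub_rev] at h
    exact (le_abs_self _).trans ((norm_le_pi_norm (_ - _ : ValueVec n) i).trans h)
  have hprob : ∑ a with a i = x, π σ s a ≤ 1 :=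
    (Finset.sum_le_univ_sum_of_nonneg (π σ s).2.1).trans_eq (π σ s).2.2
  have hγη : G.γ * η ≤ η := mul_le_of_le_one_left hη G.γ_lt_one.le
  have hloss : (∑ a with a i = x, π σ s a) * (G.γ * η) ≤ η :=
    (mul_le_of_le_one_left (mul_nonneg G.γ_nonneg hη) hprob).trans hγη
  simp only [mul_add, mul_sub, Finset.sum_add_distrib, Finset.sum_sub_distrib,
    ← Finset.sum_mul] at hdev hobey
  linarith

end Computed

/-! ### Equilibria and inducibility -/

/-- The policy computed from a target in `𝒱 s₀` on the sequences starting at `s₀`, for an arbitrary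
state `s₀`. -/
theorem isDeltaCEFrom_and_mem_neighPt [DecidableEq A] {ε δ : ℝ} (hε : 0 ≤ ε) (hδ : 0 ≤ δ)
    {𝒱 : S → Set (ValueVec n)} (hbdd : ∀ s, Bornology.IsBounded (𝒱 s))
    (hfix : 𝒱 = G.PhiHat (G.precision ε δ) 𝒱)
    {find : History n S A → S → ValueVec n → Expansion n S A}
    (hfind : G.IsFindRule (G.precision ε δ) 𝒱 find) {s₀ : S} {v : ValueVec n} (hv : v ∈ 𝒱 s₀)
    {π : CorrPolicy n S A}
    (hπ : ∀ σ s, History.start σ s = s₀ → π σ s = algOutput find v σ s) :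
    G.IsDeltaCEFrom δ s₀ π ∧ G.valueV π obey [] s₀ ∈ neighPt ε v := by
  have hmem := G.algTarget_mem hfix hfind hv
  have hexp := G.isExpansion_algLast hfix hfind hv
  have hδ' : 2 * min ε (δ / 2) ≤ δ := by linarith [min_le_right ε (δ / 2)]
  exact ⟨G.icAt_of_isExpansion hbdd hmem hexp hπ (le_min hε (by linarith)) hδ',
    (G.norm_valueV_sub_target_le hbdd hmem hexp hπ [] s₀ rfl).trans (min_le_left _ _)⟩

theorem isDeltaCE_and_mem_neighPt [DecidableEq A] {ε δ : ℝ} (hε : 0 ≤ ε) (hδ : 0 ≤ δ)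
    {𝒱 : S → Set (ValueVec n)} (hbdd : ∀ s, Bornology.IsBounded (𝒱 s))
    (hfix : 𝒱 = G.PhiHat (G.precision ε δ) 𝒱)
    {find : History n S A → S → ValueVec n → Expansion n S A}
    (hfind : G.IsFindRule (G.precision ε δ) 𝒱 find) {v : S → ValueVec n} (hv : ∀ s, v s ∈ 𝒱 s)
    {π : CorrPolicy n S A}
    (hπ : ∀ σ s, π σ s = algOutput find (v (History.start σ s)) σ s) :
    G.IsDeltaCE δ π ∧ ∀ s, G.valueV π obey [] s ∈ neighPt ε (v s) := by
  have h : ∀ s₀, G.IsDeltaCEFrom δ s₀ π ∧ G.valueV π obey [] s₀ ∈ neighPt ε (v s₀) := fun s₀ =>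
    G.isDeltaCEFrom_and_mem_neighPt hε hδ hbdd hfix hfind (hv s₀) fun σ s hs => by rw [hπ, hs]
  exact ⟨fun σ s => (h _).1 σ s rfl, fun s => (h s).2⟩

theorem isApproxInducible_of_mem [DecidableEq A] {ε δ : ℝ} (hε : 0 ≤ ε) (hδ : 0 ≤ δ)
    {𝒱 : S → Set (ValueVec n)} (hbdd : ∀ s, Bornology.IsBounded (𝒱 s))
    (hfix : 𝒱 = G.PhiHat (G.precision ε δ) 𝒱) {s : S} {v : ValueVec n} (hv : v ∈ 𝒱 s) :
    G.IsApproxInducible ε δ s v := by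
  classical
  obtain ⟨c, hc⟩ := G.exists_isExpansion hfix hv
  -- The onward values of `c` show that no `𝒱 s'` is empty; they exist because `c.dist` is a
  -- distribution over joint actions, so there is a joint action.
  obtain ⟨a⟩ : Nonempty (JointAction n A) := by
    by_contra hempty
    rw [not_nonempty_iff] at hempty
    have h1 : ∑ a, c.dist a = 1 := c.dist.2.2
    simp at h1
  let v' : S → ValueVec n := Function.update (c.onward a a) s v
  have hv' : ∀ s', v' s' ∈ 𝒱 s' := by
    intro s'
    by_cases h : s' = s
    · subst h
      simpa [v'] using hv
    · simpa [v', h] using hc.2.1.2 a a s'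
  -- The value of `find` where the search fails is irrelevant; `c` serves as a default.
  let find : History n S A → S → ValueVec n → Expansion n S A := fun _ s u =>
    if h : ∃ c, G.IsExpansion (G.precision ε δ) 𝒱 s u c then h.choose else c
  have hfind : G.IsFindRule (G.precision ε δ) 𝒱 find := by
    intro σ s u h
    simp only [find, dif_pos h]
    exact h.choose_spec
  obtain ⟨hce, hval⟩ := G.isDeltaCE_and_mem_neighPt hε hδ hbdd hfix hfind hv'
    (π := fun σ s => algOutput find (v' (History.start σ s)) σ s) fun _ _ => rfl
  refine ⟨_, ?_, _, hce, rfl⟩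
  simpa [v'] using hval s

end StochGame

theorem mainTheorem4 {n : ℕ} {S A : Type*} [Fintype S] [Fintype A] [DecidableEq A]
    (G : StochGame n S A) (ε δ : ℝ) (hε : 0 ≤ ε) (hδ : 0 ≤ δ)
    (𝒱 : S → Set (ValueVec n)) (hbdd : ∀ s, Bornology.IsBounded (𝒱 s))
    (hfix : 𝒱 = G.PhiHat (G.precision ε δ) 𝒱) :
    -- the policy computed on the sequences starting at the initial state
    (∀ v ∈ 𝒱 G.sInit, ∀ find : History n S A → S → ValueVec n → Expansion n S A,
      G.IsFindRule (G.precision ε δ) 𝒱 find →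
        -- the search step succeeds in every iteration
        (∀ σ s, History.start σ s = G.sInit →
          G.IsExpansion (G.precision ε δ) 𝒱 s (algTarget find v σ s) (algLast find v σ s)) ∧
        ∀ π : CorrPolicy n S A,
          (∀ σ s, History.start σ s = G.sInit → π σ s = algOutput find v σ s) →
            G.IsDeltaCEFrom δ G.sInit π ∧ G.valueV π obey [] G.sInit ∈ neighPt ε v) ∧
    -- the policy computed on all sequences, with one target for each starting state
    (∀ v : S → ValueVec n, (∀ s, v s ∈ 𝒱 s) →
      ∀ find : History n S A → S → ValueVec n → Expansion n S A,
        G.IsFindRule (G.precision ε δ) 𝒱 find →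
          ∀ π : CorrPolicy n S A,
            (∀ σ s, π σ s = algOutput find (v (History.start σ s)) σ s) →
              G.IsDeltaCE δ π ∧ ∀ s, G.valueV π obey [] s ∈ neighPt ε (v s)) ∧
    -- every point of the fixed point is inducible approximately
    (∀ s, ∀ v ∈ 𝒱 s, G.IsApproxInducible ε δ s v) := by
  refine ⟨fun v hv find hfind => ⟨G.isExpansion_algLast hfix hfind hv, fun π hπ => ?_⟩,
    fun v hv find hfind π hπ => ?_, fun s v hv => ?_⟩
  · exact G.isDeltaCEFrom_and_mem_neighPt hε hδ hbdd hfix hfind hv hπ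
  · exact G.isDeltaCE_and_mem_neighPt hε hδ hbdd hfix hfind hv hπ
  · exact G.isApproxInducible_of_mem hε hδ hbdd hfix hv
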